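/- Let $(\Omega,\le)$ be a (reflexive) linear order, $\mathcal{G}=(\Omega,E)$ the graph with edge set $E=\{(u,v)\in\Omega\times\Omega : u\le v\}$, endow $\Omega$ with the order topology and $E\subseteq\Omega\times\Omega$ with the relative topology of the product topology. A family $\{\psi(u,v)\}_{(u,v)\in E}$ of bounded operators on a (complex) Banach space is called a divisible dynamical system on $\mathcal{G}$ if $\psi(u,u)=\mathbf{1}$ for all $u\in\Omega$ and $\psi(u,w)=\psi(u,v)\psi(v,w)$ for all $u\le v\le w$; it is called strongly continuous if $E\ni(u,v)\mapsto\psi(u,v)\xi$ is norm-continuous for every vector $\xi$; and it is said to have geometric growth if there is a continuous function $\ell:E\to[0,\infty)$ with $\ell(u,u)=0$ for all $u\in\Omega$ and $\ell(u,w)\ge\ell(u,v)+\ell(v,w)$ for all $u\le v\le w$ (a superadditive length function) such that $\|\psi(u,v)-\mathbf{1}\|\le\ell(u,v)$ for all $(u,v)\in E$. Let $\{\varphi(u,v)\}_{(u,v)\in E}$ be a divisible dynamical system on $\mathcal{G}$ with geometric growth, consisting of contractions on a Banach space $\mathcal{X}$. Then the following hold. (a) There exist a Banach space $\tilde{\mathcal{X}}$,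 a strongly continuous divisible dynamical system $\{U(u,v)\}_{(u,v)\in E}$ on $\mathcal{G}$ consisting of surjective linear isometries on $\tilde{\mathcal{X}}$, a surjective linear contraction $j:\tilde{\mathcal{X}}\to\mathcal{X}$ and a linear isometry $r:\mathcal{X}\to\tilde{\mathcal{X}}$ with $j\circ r=\mathbf{1}$, such that $j\,U(u,v)\,r=\varphi(u,v)$ for all $(u,v)\in E$. (b) Suppose that $\mathcal{X}=\mathcal{A}$ is a (commutative) unital $C^{*}$-algebra and that each $\varphi(u,v)$ is a positive unital linear operator on $\mathcal{A}$. Then there exist a (commutative) unital $C^{*}$-algebra $\tilde{\mathcal{A}}$, a strongly continuous divisible dynamical system $\{U(u,v)\}_{(u,v)\in E}$ on $\mathcal{G}$ consisting of $*$-automorphisms of $\tilde{\mathcal{A}}$, a surjective unital $*$-homomorphism $j:\tilde{\mathcal{A}}\to\mathcal{A}$ and an isometric positive unital linear map $r:\mathcal{A}\to\tilde{\mathcal{A}}$ with $j\circ r=\mathrm{id}_{\mathcal{A}}$, such that $j\,U(u,v)\,r=\varphi(u,v)$ for all $(u,v)\in E$. Here, if $\mathcal{A}$ is commutative, $\tilde{\mathcal{A}}$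 can be chosen commutative. -/

import Mathlib

open scoped NNReal

universe u v

namespace GraphDilation

/-! A graph is a set `Ω` of nodes together with a set `E : Set (Ω × Ω)` of edges.  A family of
bounded operators on the graph is a map `φ : E → (X →L[ℂ] X)`.  If `Ω` is a topological space,
`E` carries the subspace topology of the product topology. -/

/-- The edge set of a (reflexive) linear order: `{(u, v) | u ≤ v}`. -/
def orderEdges (Ω : Type*) [LinearOrder Ω] : Set (Ω × Ω) := {p | p.1 ≤ p.2}

section Operators

variable {Ω : Type*} {E : Set (Ω × Ω)} {X : Type*} [NormedAddCommGroup X] [NormedSpace ℂ X]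

/-- A divisible dynamical system on the graph `(Ω, E)`: the identity axiom `φ(u,u) = 1` and the
divisibility axiom `φ(u,w) = φ(u,v) φ(v,w)`, for all edges for which they make sense. -/
structure IsDivisibleSystem (φ : E → (X →L[ℂ] X)) : Prop where
  identity : ∀ (a : Ω) (h : (a, a) ∈ E), φ ⟨(a, a), h⟩ = ContinuousLinearMap.id ℂ X
  divisible : ∀ (a b c : Ω) (hab : (a, b) ∈ E) (hbc : (b, c) ∈ E) (hac : (a, c) ∈ E),
    φ ⟨(a, c), hac⟩ = (φ ⟨(a, b), hab⟩).comp (φ ⟨(b, c), hbc⟩)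

/-- Continuity of the family with respect to the strong operator topology. -/
def StronglyContinuous [TopologicalSpace Ω] (φ : E → (X →L[ℂ] X)) : Prop :=
  ∀ x : X, Continuous fun e : E => φ e x

/-- Superadditive length functions on the edges of the graph `(Ω, E)`. -/
structure IsSuperadditiveLength [TopologicalSpace Ω] (ℓ : E → ℝ≥0) : Prop where
  continuous : Continuous ℓ
  loop : ∀ (a : Ω) (h : (a, a) ∈ E), ℓ ⟨(a, a), h⟩ = 0
  superadd : ∀ (a b c : Ω) (hab : (a, b) ∈ E) (hbc : (b, c) ∈ E) (hac : (a, c) ∈ E),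
    ℓ ⟨(a, b), hab⟩ + ℓ ⟨(b, c), hbc⟩ ≤ ℓ ⟨(a, c), hac⟩

/-- Geometric growth of an operator family: `‖φ(u,v) - 1‖ ≤ ℓ(u,v)` on all edges, for some
superadditive length function `ℓ`. -/
def HasGeometricGrowth [TopologicalSpace Ω] (φ : E → (X →L[ℂ] X)) : Prop :=
  ∃ ℓ : E → ℝ≥0, IsSuperadditiveLength ℓ ∧
    ∀ e : E, ‖φ e - ContinuousLinearMap.id ℂ X‖ ≤ (ℓ e : ℝ)

end Operators

end GraphDilation

/-! The dilation acts on functions of *unions of intervals*. A finite set `F = {v₁ < ⋯ < v₂ₖ}` of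
nodes is the set of endpoints of `[v₁, v₂) ∪ ⋯ ∪ [v₂ₖ₋₁, v₂ₖ)`, and symmetric difference of endpoint
sets corresponds to symmetric difference of these unions. Attach to `F` the ordered product
`Φ(F) = φ(v₁,v₂) ⋯ φ(v₂ₖ₋₁,v₂ₖ)` (`multisetProd`), and `Φ(F) = 1` if `F` has an odd number of elements.
On bounded `X`-valued functions of `F`, let

* `U(u, v) f (F) = f (F ∆ {u} ∆ {v})`, an isometric involution; `U(u, v) U(v, w) = U(u, w)` because
  the two copies of `v` cancel;
* `r x (F) = Φ(F) x` and `j f = f(∅)`, so that `j U(u, v) r x = Φ({u} ∆ {v}) x = φ(u, v) x`.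

It remains to obtain strong continuity. The functions with norm-continuous orbit
(`continuousOrbits`) form a closed subspace, which is invariant because the `U(u, v)` commute, and
which is a C⋆-subalgebra if `X` is a C⋆-algebra. It contains every `r x` by the estimate
`‖Φ(F ∆ {u} ∆ {v}) - Φ(F)‖ ≤ 2 ℓ(u, v)` for `u ≤ v`
(`IsContractiveEvolution.norm_multisetProd_symmDiff_sub_le`): only the factors inside `[u, v]` change,
and by superadditivity of `ℓ` a product of such factors is within `ℓ(u, v)` of the identity.

In the C⋆-algebraic case, `U(u, v)` and `j` are multiplicative since they are compositions with, and
evaluations at, points, and `r` is positive because positivity in an algebra of bounded functions is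
pointwise. -/

namespace GraphDilation

open scoped symmDiff BoundedContinuousFunction Topology
open Filter

/-! ### Products over finite unions of intervals -/

section Products

variable {Ω : Type*} [LinearOrder Ω] {X : Type*} [NormedAddCommGroup X] [NormedSpace ℂ X]

/-- The data of a contractive divisible system of geometric growth, extended to all pairs of nodes
so that no proofs of `a ≤ b` have to be carried around. -/
structure IsContractiveEvolution (p : Ω → Ω → (X →L[ℂ] X)) (ℓ : Ω → Ω → ℝ) : Prop where
  self (a : Ω) : p a a = 1
  mul {a b c : Ω} : a ≤ b → b ≤ c → p a b * p b c = p a c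
  norm_le (a b : Ω) : ‖p a b‖ ≤ 1
  length_self (a : Ω) : ℓ a a = 0
  nonneg (a b : Ω) : 0 ≤ ℓ a b
  superadd {a b c : Ω} : a ≤ b → b ≤ c → ℓ a b + ℓ b c ≤ ℓ a c
  growth {a b : Ω} : a ≤ b → ‖p a b - 1‖ ≤ ℓ a b

/-- The product `p(a₁,a₂) p(a₃,a₄) ⋯`, over consecutive disjoint pairs of a list; an unpaired last
entry is ignored. -/
def pairProd (p : Ω → Ω → (X →L[ℂ] X)) : List Ω → (X →L[ℂ] X)
  | [] => 1
  | [_] => 1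
  | a :: b :: l => p a b * pairProd p l

omit [LinearOrder Ω] in
theorem pairProd_mem (p : Ω → Ω → (X →L[ℂ] X)) (S : Submonoid (X →L[ℂ] X))
    (hp : ∀ a b, p a b ∈ S) : ∀ l, pairProd p l ∈ S
  | [] => S.one_mem
  | [_] => S.one_mem
  | a :: b :: l => S.mul_mem (hp a b) (pairProd_mem p S hp l)

variable {p : Ω → Ω → (X →L[ℂ] X)} {ℓ : Ω → Ω → ℝ}

namespace IsContractiveEvolution

variable (h : IsContractiveEvolution p ℓ)
include h

theorem norm_pairProd_le : ∀ l, ‖pairProd p l‖ ≤ 1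
  | [] => ContinuousLinearMap.norm_id_le
  | [_] => ContinuousLinearMap.norm_id_le
  | a :: b :: l => (norm_mul_le _ _).trans
      (mul_le_one₀ (h.norm_le a b) (norm_nonneg _) (norm_pairProd_le l))

theorem length_mono {a b c d : Ω} (hab : a ≤ b) (hbc : b ≤ c) (hcd : c ≤ d) : ℓ b c ≤ ℓ a d := by
  linarith [h.superadd hab (hbc.trans hcd), h.superadd hbc hcd, h.nonneg a b, h.nonneg c d]

theorem norm_mul_sub_mul_le (a b : Ω) (S T : X →L[ℂ] X) : ‖p a b * S - p a b * T‖ ≤ ‖S - T‖ := by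
  rw [← mul_sub]
  exact (norm_mul_le _ _).trans (mul_le_of_le_one_left (norm_nonneg _) (h.norm_le a b))

theorem norm_mul_sub_le {a b : Ω} (hab : a ≤ b) {T : X →L[ℂ] X} (hT : ‖T‖ ≤ 1) :
    ‖p a b * T - T‖ ≤ ℓ a b := by
  have : p a b * T - T = (p a b - 1) * T := by rw [sub_mul, one_mul]
  rw [this]
  exact (norm_mul_le _ _).trans
    ((mul_le_of_le_one_right (norm_nonneg _) hT).trans (h.growth hab))

/-- An even number of endpoints in `[u, v]` in front of a list changes the product by at most
`ℓ(u, v)`. -/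
theorem norm_pairProd_append_sub_le_of_even {v : Ω} (L : List Ω) :
    ∀ (M : List Ω) (u : Ω), u ≤ v → M.Pairwise (· ≤ ·) → (∀ x ∈ M, u ≤ x ∧ x ≤ v) →
      Even M.length → ‖pairProd p (M ++ L) - pairProd p L‖ ≤ ℓ u v
  | [], u, _, _, _, _ => by simpa using h.nonneg u v
  | [a], _, _, _, _, hM => by simp at hM
  | a :: b :: M, u, _, hs, hm, hM => by
    simp only [List.pairwise_cons, List.mem_cons, forall_eq_or_imp] at hs hm
    obtain ⟨⟨hab, -⟩, hbM, hs⟩ := hs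
    have ih := norm_pairProd_append_sub_le_of_even L M b hm.2.1.2 hs
      (fun x hx => ⟨hbM x hx, (hm.2.2 x hx).2⟩) (by simpa [Nat.even_add_one] using hM)
    have h1 := h.norm_mul_sub_le hab (h.norm_pairProd_le (M ++ L))
    have h2 := h.superadd hab hm.2.1.2
    have h3 := h.length_mono hm.1.1 hm.1.2 le_rfl
    have h4 := norm_sub_le_norm_sub_add_norm_sub (p a b * pairProd p (M ++ L))
      (pairProd p (M ++ L)) (pairProd p L)
    simp only [List.cons_append, pairProd]
    linarith

/-- An odd number of endpoints in `[u, v]` in front of a list acts like the single endpoint `v`, up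
to `ℓ(u, v)`. -/
theorem norm_pairProd_append_sub_le_of_odd {v c : Ω} (hvc : v ≤ c) (L : List Ω) :
    ∀ (M : List Ω) (u : Ω), M.Pairwise (· ≤ ·) → (∀ x ∈ M, u ≤ x ∧ x ≤ v) →
      Odd M.length → ‖pairProd p (M ++ c :: L) - pairProd p (v :: c :: L)‖ ≤ ℓ u v
  | [], _, _, _, hM => by simp at hM
  | [a], u, _, hm, _ => by
    simp only [List.mem_singleton, forall_eq] at hm
    have h1 := h.norm_mul_sub_le hm.2 (h.norm_pairProd_le (v :: c :: L))
    have h2 := h.length_mono hm.1 hm.2 le_rfl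
    simp only [List.cons_append, List.nil_append, pairProd, ← mul_assoc, h.mul hm.2 hvc] at h1 ⊢
    exact h1.trans h2
  | a :: b :: M, u, hs, hm, hM => by
    simp only [List.pairwise_cons, List.mem_cons, forall_eq_or_imp] at hs hm
    obtain ⟨⟨hab, -⟩, hbM, hs⟩ := hs
    have ih := norm_pairProd_append_sub_le_of_odd hvc L M b hs
      (fun x hx => ⟨hbM x hx, (hm.2.2 x hx).2⟩) (by simpa [Nat.odd_add_one] using hM)
    have h1 := h.norm_mul_sub_le hab (h.norm_pairProd_le (M ++ c :: L))
    have h2 := h.superadd hab hm.2.1.2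
    have h3 := h.length_mono hm.1.1 hm.1.2 le_rfl
    have h4 := norm_sub_le_norm_sub_add_norm_sub (p a b * pairProd p (M ++ c :: L))
      (pairProd p (M ++ c :: L)) (pairProd p (v :: c :: L))
    rw [List.cons_append, List.cons_append, pairProd]
    linarith

/-- Two sets of endpoints in `[u, v]` of the same parity are interchangeable in front of a list, up
to `2 ℓ(u, v)`. -/
theorem norm_pairProd_append_sub_append_le {u v : Ω} (huv : u ≤ v) {L M N : List Ω}
    (hL : ∀ x ∈ L, v ≤ x) (hM : M.Pairwise (· ≤ ·)) (hN : N.Pairwise (· ≤ ·))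
    (hMm : ∀ x ∈ M, u ≤ x ∧ x ≤ v) (hNm : ∀ x ∈ N, u ≤ x ∧ x ≤ v)
    (hML : Even (M.length + L.length)) (hNL : Even (N.length + L.length)) :
    ‖pairProd p (M ++ L) - pairProd p (N ++ L)‖ ≤ 2 * ℓ u v := by
  have key : ∃ T, ‖pairProd p (M ++ L) - T‖ ≤ ℓ u v ∧ ‖pairProd p (N ++ L) - T‖ ≤ ℓ u v := by
    rcases Nat.even_or_odd L.length with hl | hl
    · rw [Nat.even_add, iff_true_right hl] at hML hNL
      exact ⟨_, h.norm_pairProd_append_sub_le_of_even L M u huv hM hMm hML,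
        h.norm_pairProd_append_sub_le_of_even L N u huv hN hNm hNL⟩
    · rw [Nat.even_add, iff_false_right (Nat.not_even_iff_odd.2 hl), Nat.not_even_iff_odd]
        at hML hNL
      cases L with
      | nil => simp at hl
      | cons c L =>
        have hvc := hL c (by simp)
        exact ⟨_, h.norm_pairProd_append_sub_le_of_odd hvc L M u hM hMm hML,
          h.norm_pairProd_append_sub_le_of_odd hvc L N u hN hNm hNL⟩
  obtain ⟨T, h1, h2⟩ := key
  have := norm_sub_le_norm_sub_add_norm_sub (pairProd p (M ++ L)) T (pairProd p (N ++ L))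
  rw [norm_sub_rev T] at this
  linarith

/-- Inserting two endpoints `u ≤ v` into a sorted list of even length changes the product by at
most `2 ℓ(u, v)`: on splitting the intervals at `u` and `v`, the factors left and right of `[u, v]`
agree, and the product of the factors in between is within `ℓ(u, v)` of the identity. -/
theorem norm_pairProd_insert_sub_le {u v : Ω} {M L : List Ω} :
    ∀ K : List Ω, (K ++ u :: (M ++ v :: L)).Pairwise (· ≤ ·) →
      Even (K ++ (M ++ L)).length →
      ‖pairProd p (K ++ u :: (M ++ v :: L)) - pairProd p (K ++ (M ++ L))‖ ≤ 2 * ℓ u v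
  | [], hs, hl => by
    simp only [List.nil_append, List.pairwise_cons, List.pairwise_append, List.mem_append,
      List.mem_cons, List.length_append, forall_eq_or_imp] at hs hl ⊢
    obtain ⟨hu, hM, ⟨hvL, hL⟩, hMv⟩ := hs
    have huv := hu v (by simp)
    have := h.norm_pairProd_append_sub_append_le huv (M := u :: (M ++ [v])) (N := M) hvL
      (by simpa [List.pairwise_append, huv, hM] using
        ⟨fun a ha => hu a (ha.imp_right .inl), fun a ha => (hMv a ha).1⟩) hM
      (by
        simp only [List.mem_cons, List.mem_append, List.not_mem_nil, or_false]
        rintro x (rfl | hx | rfl)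
        · exact ⟨le_rfl, huv⟩
        · exact ⟨hu x (.inl hx), (hMv x hx).1⟩
        · exact ⟨huv, le_rfl⟩)
      (fun x hx => ⟨hu x (.inl hx), (hMv x hx).1⟩)
      (by simp only [List.length_cons, List.length_append, List.length_nil]; grind) hl
    simpa using this
  | [a], hs, hl => by
    simp only [List.cons_append, List.nil_append, List.pairwise_cons, List.pairwise_append,
      List.mem_append, List.mem_cons, List.length_append, List.length_cons,
      forall_eq_or_imp] at hs hl ⊢
    obtain ⟨⟨hau, haM⟩, hu, hM, ⟨hvL, hL⟩, hMv⟩ := hs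
    have huv := hu v (by simp)
    -- Splitting `p a c = p a u * p u c` for the next endpoint `c` puts `u` into the second list.
    have hsplit : pairProd p (a :: (M ++ L)) = p a u * pairProd p (u :: (M ++ L)) := by
      have hne : ∀ x ∈ M ++ L, u ≤ x := fun x hx => by
        rcases List.mem_append.1 hx with hx | hx
        · exact hu x (.inl hx)
        · exact hu x (.inr (.inr hx))
      have hl' : Even ((M ++ L).length + 1) := by simpa using hl
      generalize M ++ L = R at hne hl'
      cases R with
      | nil => simp at hl'
      | cons c R => simp only [pairProd, ← mul_assoc, h.mul hau (hne c (by simp))]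
    rw [hsplit, pairProd]
    refine (h.norm_mul_sub_mul_le _ _ _ _).trans ?_
    have := h.norm_pairProd_append_sub_append_le huv (M := M ++ [v]) (N := u :: M) hvL
      (by simpa [List.pairwise_append, hM] using fun a ha => (hMv a ha).1)
      (List.pairwise_cons.2 ⟨fun x hx => hu x (.inl hx), hM⟩)
      (by
        simp only [List.mem_append, List.mem_singleton]
        rintro x (hx | rfl)
        · exact ⟨hu x (.inl hx), (hMv x hx).1⟩
        · exact ⟨huv, le_rfl⟩)
      (by
        simp only [List.mem_cons]
        rintro x (rfl | hx)
        · exact ⟨le_rfl, huv⟩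
        · exact ⟨hu x (.inl hx), (hMv x hx).1⟩)
      (by simp only [List.length_append, List.length_cons, List.length_nil]; grind)
      (by simp only [List.length_cons]; grind)
    simpa using this
  | a :: b :: K, hs, hl => by
    simp only [List.cons_append, pairProd]
    refine (h.norm_mul_sub_mul_le _ _ _ _).trans (norm_pairProd_insert_sub_le K ?_ ?_)
    · exact (List.pairwise_cons.1 (List.pairwise_cons.1 hs).2).2
    · simpa [Nat.even_add_one] using hl

end IsContractiveEvolution

/-- The operator attached to a multiset of endpoints: the product over the intervals bounded by
consecutive endpoints if their number is even, and the identity otherwise (the last interval is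
then unbounded, and no operator belongs to it). Since adding two endpoints preserves parity, the two
cases never interact. -/
noncomputable def multisetProd (p : Ω → Ω → (X →L[ℂ] X)) (m : Multiset Ω) : X →L[ℂ] X :=
  if Even m.card then pairProd p m.sort else 1

theorem multisetProd_mem (p : Ω → Ω → (X →L[ℂ] X)) (S : Submonoid (X →L[ℂ] X))
    (hp : ∀ a b, p a b ∈ S) (m : Multiset Ω) : multisetProd p m ∈ S := by
  unfold multisetProd
  split_ifs
  exacts [pairProd_mem p S hp _, S.one_mem]

theorem sort_coe_of_pairwise {l : List Ω} (hl : l.Pairwise (· ≤ ·)) :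
    (l : Multiset Ω).sort = l :=
  List.Perm.eq_of_pairwise (fun _ _ _ _ => le_antisymm) (Multiset.pairwise_sort _ _) hl
    (Multiset.coe_eq_coe.1 (Multiset.sort_eq _ _))

theorem multisetProd_pair {u v : Ω} (huv : u ≤ v) : multisetProd p {u, v} = p u v := by
  have : ({u, v} : Multiset Ω) = (([u, v] : List Ω) : Multiset Ω) := rfl
  rw [multisetProd, if_pos (by simp), this, sort_coe_of_pairwise (by simpa using huv)]
  simp [pairProd]

theorem multisetProd_empty : multisetProd p (∅ : Finset Ω).val = 1 := by
  simp [multisetProd, pairProd]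

/-- The three lists are the parts of `m` below `u`, in `[u, v)`, and from `v` onwards. -/
theorem exists_sorted_insert {u v : Ω} (huv : u ≤ v) (m : Multiset Ω) :
    ∃ K M L : List Ω, (K ++ u :: (M ++ v :: L)).Pairwise (· ≤ ·) ∧
      m = ↑(K ++ (M ++ L)) := by
  refine ⟨(m.filter (· < u)).sort, ((m.filter (¬ · < u)).filter (· < v)).sort,
    ((m.filter (¬ · < u)).filter (¬ · < v)).sort, ?_, ?_⟩
  · simp only [List.pairwise_append, List.pairwise_cons, Multiset.pairwise_sort, Multiset.mem_sort,
      List.mem_append, List.mem_cons, Multiset.mem_filter, not_lt]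
    grind
  · simp only [← Multiset.coe_add, Multiset.sort_eq, Multiset.filter_add_not]

namespace IsContractiveEvolution

variable (h : IsContractiveEvolution p ℓ)
include h

theorem norm_multisetProd_le (m : Multiset Ω) : ‖multisetProd p m‖ ≤ 1 := by
  unfold multisetProd
  split_ifs
  exacts [h.norm_pairProd_le _, ContinuousLinearMap.norm_id_le]

theorem norm_multisetProd_cons_cons_sub_le {u v : Ω} (huv : u ≤ v) (m : Multiset Ω) :
    ‖multisetProd p (u ::ₘ v ::ₘ m) - multisetProd p m‖ ≤ 2 * ℓ u v := by
  obtain ⟨K, M, L, hs, rfl⟩ := exists_sorted_insert huv m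
  have hperm : (u ::ₘ v ::ₘ ((K ++ (M ++ L) : List Ω) : Multiset Ω)) =
      ((K ++ u :: (M ++ v :: L) : List Ω) : Multiset Ω) := by
    simp only [← Multiset.coe_add, ← Multiset.cons_coe, Multiset.add_cons]
  have hs' : (K ++ (M ++ L)).Pairwise (· ≤ ·) :=
    hs.sublist (by
      gcongr
      exact (List.Sublist.append_left (List.sublist_cons_self _ _) _).cons _)
  by_cases he : Even (K ++ (M ++ L)).length
  · have he' : Even (Multiset.card (u ::ₘ v ::ₘ ((K ++ (M ++ L) : List Ω) : Multiset Ω))) := by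
      simpa [Nat.even_add_one] using he
    rw [multisetProd, multisetProd, if_pos he', if_pos (by simpa using he), hperm,
      sort_coe_of_pairwise hs, sort_coe_of_pairwise hs']
    exact h.norm_pairProd_insert_sub_le K hs he
  · have he' : ¬ Even (Multiset.card (u ::ₘ v ::ₘ ((K ++ (M ++ L) : List Ω) : Multiset Ω))) := by
      simpa [Nat.even_add_one] using he
    rw [multisetProd, multisetProd, if_neg he', if_neg (by simpa using he), sub_self, norm_zero]
    exact mul_nonneg zero_le_two (h.nonneg u v)

/-- Toggling the endpoint `u` in a finite set has the same effect as adding it as a multiset. The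
summand `m` makes the lemma usable inside sums, when several endpoints are toggled in turn. -/
theorem multisetProd_symmDiff_add (F : Finset Ω) (u : Ω) (m : Multiset Ω) :
    multisetProd p ((F ∆ {u}).val + m) = multisetProd p (u ::ₘ (F.val + m)) := by
  by_cases hu : u ∈ F
  · have h1 : F ∆ {u} = F.erase u := by ext x; simp [Finset.mem_symmDiff]; grind
    have h2 : F.val = u ::ₘ (F.erase u).val := by
      rw [Finset.erase_val, Multiset.cons_erase hu]
    -- A doubled endpoint cancels, as it bounds an interval of length `ℓ(u, u) = 0`.
    have h3 := h.norm_multisetProd_cons_cons_sub_le (le_refl u) ((F.erase u).val + m)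
    rw [h.length_self, mul_zero, norm_le_zero_iff, sub_eq_zero] at h3
    rw [h1, h2, Multiset.cons_add, h3]
  · have h1 : F ∆ {u} = F.cons u hu := by ext x; simp [Finset.mem_symmDiff]; grind
    rw [h1, Finset.cons_val, Multiset.cons_add]

theorem norm_multisetProd_symmDiff_sub_le {u v : Ω} (huv : u ≤ v) (F : Finset Ω) :
    ‖multisetProd p ((F ∆ {u}) ∆ {v}).val - multisetProd p F.val‖ ≤ 2 * ℓ u v := by
  have h1 := h.multisetProd_symmDiff_add (F ∆ {u}) v 0
  have h2 := h.multisetProd_symmDiff_add F u {v}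
  rw [add_zero, add_zero, ← Multiset.singleton_add, add_comm, h2, add_comm,
    Multiset.singleton_add] at h1
  rw [h1]
  exact h.norm_multisetProd_cons_cons_sub_le huv F.val

theorem multisetProd_symmDiff_empty {u v : Ω} (huv : u ≤ v) :
    multisetProd p (((∅ : Finset Ω) ∆ {u}) ∆ {v}).val = p u v := by
  have h1 := h.multisetProd_symmDiff_add ((∅ : Finset Ω) ∆ {u}) v 0
  have h2 := h.multisetProd_symmDiff_add (∅ : Finset Ω) u {v}
  rw [add_zero, add_zero, ← Multiset.singleton_add, add_comm, h2, add_comm] at h1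
  rw [h1, ← multisetProd_pair (p := p) huv]
  rfl

end IsContractiveEvolution

end Products

/-! ### Translations on functions of finite sets of endpoints -/

section Shifts

variable {Ω : Type*} [LinearOrder Ω] [TopologicalSpace (Finset Ω)] [DiscreteTopology (Finset Ω)]
  {X : Type*} [NormedAddCommGroup X] [NormedSpace ℂ X]

variable (X) in
/-- Translation of bounded functions on the group of finite subsets of `Ω` (under symmetric
difference) by the pair of endpoints of an edge. -/
noncomputable def edgeShift (e : orderEdges Ω) : (Finset Ω →ᵇ X) →L[ℂ] (Finset Ω →ᵇ X) :=
  BoundedContinuousFunction.compContinuousCLM X ℂ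
    ⟨fun F => (F ∆ {e.1.1}) ∆ {e.1.2}, continuous_of_discreteTopology⟩

@[simp]
theorem edgeShift_apply (e : orderEdges Ω) (f : Finset Ω →ᵇ X) (F : Finset Ω) :
    edgeShift X e f F = f ((F ∆ {e.1.1}) ∆ {e.1.2}) := rfl

theorem edgeShift_comm (e e' : orderEdges Ω) (f : Finset Ω →ᵇ X) :
    edgeShift X e (edgeShift X e' f) = edgeShift X e' (edgeShift X e f) := by
  ext F
  simp only [edgeShift_apply, symmDiff_assoc]
  congr 2
  rw [← symmDiff_assoc {e.1.1}, ← symmDiff_assoc {e'.1.1}, symmDiff_comm]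

theorem edgeShift_edgeShift (e : orderEdges Ω) (f : Finset Ω →ᵇ X) :
    edgeShift X e (edgeShift X e f) = f := by
  ext F
  simp only [edgeShift_apply]
  rw [symmDiff_right_comm F {e.1.1} {e.1.2}, symmDiff_symmDiff_cancel_right,
    symmDiff_symmDiff_cancel_right]

theorem edgeShift_self (a : Ω) (h : (a, a) ∈ orderEdges Ω) (f : Finset Ω →ᵇ X) :
    edgeShift X ⟨(a, a), h⟩ f = f := by
  ext F
  simp

theorem edgeShift_trans {a b c : Ω} (hab : (a, b) ∈ orderEdges Ω) (hbc : (b, c) ∈ orderEdges Ω)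
    (hac : (a, c) ∈ orderEdges Ω) (f : Finset Ω →ᵇ X) :
    edgeShift X ⟨(a, c), hac⟩ f = edgeShift X ⟨(a, b), hab⟩ (edgeShift X ⟨(b, c), hbc⟩ f) := by
  ext F
  simp

theorem norm_edgeShift_le (e : orderEdges Ω) (f : Finset Ω →ᵇ X) : ‖edgeShift X e f‖ ≤ ‖f‖ :=
  BoundedContinuousFunction.norm_compContinuous_le f _

theorem norm_edgeShift (e : orderEdges Ω) (f : Finset Ω →ᵇ X) : ‖edgeShift X e f‖ = ‖f‖ := by
  refine (norm_edgeShift_le e f).antisymm ?_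
  simpa only [edgeShift_edgeShift] using norm_edgeShift_le e (edgeShift X e f)

variable [TopologicalSpace Ω]

variable (Ω X) in
/-- The bounded functions on the finite subsets of `Ω` on which the translations by edges act
strongly continuously. -/
noncomputable def continuousOrbits : Submodule ℂ (Finset Ω →ᵇ X) where
  carrier := {f | Continuous fun e : orderEdges Ω => edgeShift X e f}
  add_mem' hf hg := by
    simp only [Set.mem_ofPred_eq, map_add] at *
    exact hf.add hg
  zero_mem' := by simpa using continuous_const
  smul_mem' c f hf := by
    simp only [Set.mem_ofPred_eq, map_smul] at *
    exact hf.const_smul c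

theorem mem_continuousOrbits {f : Finset Ω →ᵇ X} :
    f ∈ continuousOrbits Ω X ↔ Continuous fun e : orderEdges Ω => edgeShift X e f := Iff.rfl

theorem isClosed_continuousOrbits :
    IsClosed (continuousOrbits Ω X : Set (Finset Ω →ᵇ X)) := by
  refine isClosed_of_closure_subset fun f hf => ?_
  refine continuous_of_uniform_approx_of_continuous fun s hs => ?_
  obtain ⟨ε, hε, hεs⟩ := Metric.mem_uniformity_dist.1 hs
  obtain ⟨g, hg, hfg⟩ := Metric.mem_closure_iff.1 hf ε hε
  refine ⟨fun e => edgeShift X e g, hg, fun e => hεs ?_⟩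
  rw [dist_eq_norm, ← map_sub, norm_edgeShift, ← dist_eq_norm]
  exact hfg

theorem edgeShift_mem (e : orderEdges Ω) {f : Finset Ω →ᵇ X} (hf : f ∈ continuousOrbits Ω X) :
    edgeShift X e f ∈ continuousOrbits Ω X := by
  rw [mem_continuousOrbits] at *
  simp only [edgeShift_comm _ e]
  exact (edgeShift X e).continuous.comp hf

end Shifts

/-! ### Embedding by orbit functions -/

section Lift

variable {Ω : Type*} [LinearOrder Ω] [TopologicalSpace (Finset Ω)] [DiscreteTopology (Finset Ω)]
  {X : Type*} [NormedAddCommGroup X] [NormedSpace ℂ X]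
  {p : Ω → Ω → (X →L[ℂ] X)} {ℓ : Ω → Ω → ℝ}

/-- The embedding of `X` that sends `x` to its orbit function `F ↦ multisetProd p F x`. -/
noncomputable def IsContractiveEvolution.lift (h : IsContractiveEvolution p ℓ) :
    X →ₗᵢ[ℂ] (Finset Ω →ᵇ X) where
  toFun x := BoundedContinuousFunction.ofNormedAddCommGroupDiscrete
    (fun F => multisetProd p F.val x) ‖x‖ fun F =>
      (ContinuousLinearMap.le_of_opNorm_le _ (h.norm_multisetProd_le _) x).trans_eq (one_mul _)
  map_add' x y := by ext F; simp
  map_smul' c x := by ext F; simp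
  norm_map' x := by
    refine le_antisymm ((BoundedContinuousFunction.norm_le (norm_nonneg x)).2 fun F =>
      (ContinuousLinearMap.le_of_opNorm_le _ (h.norm_multisetProd_le _) x).trans_eq (one_mul _)) ?_
    refine Eq.trans_le ?_ (BoundedContinuousFunction.norm_coe_le_norm _ ∅)
    change ‖x‖ = ‖multisetProd p (∅ : Finset Ω).val x‖
    rw [multisetProd_empty]
    rfl

theorem IsContractiveEvolution.lift_apply (h : IsContractiveEvolution p ℓ) (x : X)
    (F : Finset Ω) : h.lift x F = multisetProd p F.val x := rfl

theorem IsContractiveEvolution.lift_empty (h : IsContractiveEvolution p ℓ) (x : X) :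
    h.lift x ∅ = x := by
  rw [h.lift_apply, multisetProd_empty]
  rfl

theorem IsContractiveEvolution.edgeShift_lift_empty (h : IsContractiveEvolution p ℓ) (x : X)
    (e : orderEdges Ω) : edgeShift X e (h.lift x) ∅ = p e.1.1 e.1.2 x := by
  rw [edgeShift_apply, h.lift_apply, h.multisetProd_symmDiff_empty e.2]

omit [TopologicalSpace (Finset Ω)] [DiscreteTopology (Finset Ω)] in
theorem IsContractiveEvolution.norm_multisetProd_symmDiff_sub_le_min_max
    (h : IsContractiveEvolution p ℓ) (u v : Ω) (F : Finset Ω) :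
    ‖multisetProd p ((F ∆ {u}) ∆ {v}).val - multisetProd p F.val‖ ≤
      2 * ℓ (min u v) (max u v) := by
  rcases le_total u v with huv | huv
  · simpa [huv] using h.norm_multisetProd_symmDiff_sub_le huv F
  · rw [symmDiff_right_comm]
    simpa [huv] using h.norm_multisetProd_symmDiff_sub_le huv F

theorem IsContractiveEvolution.lift_mem [TopologicalSpace Ω] (h : IsContractiveEvolution p ℓ)
    (hℓ : ∀ a, Tendsto (fun b => ℓ (min a b) (max a b)) (𝓝 a) (𝓝 0)) (x : X) :
    h.lift x ∈ continuousOrbits Ω X := by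
  rw [mem_continuousOrbits, continuous_iff_continuousAt]
  intro e₀
  rw [ContinuousAt, tendsto_iff_norm_sub_tendsto_zero]
  -- `[u, v)` differs from `[u₀, v₀)` by the intervals between `u₀, u` and between `v₀, v`.
  have hle (e : orderEdges Ω) : ‖edgeShift X e (h.lift x) - edgeShift X e₀ (h.lift x)‖ ≤
      (2 * ℓ (min e₀.1.2 e.1.2) (max e₀.1.2 e.1.2) +
        2 * ℓ (min e₀.1.1 e.1.1) (max e₀.1.1 e.1.1)) * ‖x‖ := by
    have hnn := add_nonneg (mul_nonneg zero_le_two (h.nonneg (min e₀.1.2 e.1.2) (max e₀.1.2 e.1.2)))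
      (mul_nonneg zero_le_two (h.nonneg (min e₀.1.1 e.1.1) (max e₀.1.1 e.1.1)))
    refine (BoundedContinuousFunction.norm_le (mul_nonneg hnn (norm_nonneg x))).2 fun F => ?_
    rw [BoundedContinuousFunction.sub_apply, edgeShift_apply, edgeShift_apply, h.lift_apply,
      h.lift_apply, ← sub_apply]
    refine ContinuousLinearMap.le_of_opNorm_le _ ?_ x
    set G := (F ∆ {e₀.1.1}) ∆ {e₀.1.2}
    have hG : (F ∆ {e.1.1}) ∆ {e.1.2} = (((G ∆ {e₀.1.1}) ∆ {e.1.1}) ∆ {e₀.1.2}) ∆ {e.1.2} := by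
      rw [symmDiff_right_comm (G ∆ {e₀.1.1}), symmDiff_right_comm G, symmDiff_symmDiff_cancel_right,
        symmDiff_symmDiff_cancel_right]
    rw [hG]
    exact (norm_sub_le_norm_sub_add_norm_sub _ _ _).trans (add_le_add
      (h.norm_multisetProd_symmDiff_sub_le_min_max _ _ _) (h.norm_multisetProd_symmDiff_sub_le_min_max _ _ _))
  have h1 : Tendsto (fun e : orderEdges Ω => e.1.1) (𝓝 e₀) (𝓝 e₀.1.1) :=
    (continuous_fst.comp continuous_subtype_val).tendsto e₀
  have h2 : Tendsto (fun e : orderEdges Ω => e.1.2) (𝓝 e₀) (𝓝 e₀.1.2) :=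
    (continuous_snd.comp continuous_subtype_val).tendsto e₀
  refine squeeze_zero (fun _ => norm_nonneg _) hle ?_
  simpa using ((((hℓ e₀.1.2).comp h2).const_mul 2).add
    (((hℓ e₀.1.1).comp h1).const_mul 2)).mul_const ‖x‖

end Lift

/-! ### Extending families from edges to pairs of nodes -/

section Extension

variable {Ω : Type*} [LinearOrder Ω] {X : Type*} [NormedAddCommGroup X] [NormedSpace ℂ X]

theorem mem_orderEdges {a b : Ω} : (a, b) ∈ orderEdges Ω ↔ a ≤ b := Iff.rfl

/-- Extension of a family on the edges to all pairs of nodes, by a default value. -/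
def extendEdges {α : Type*} (d : α) (φ : orderEdges Ω → α) (a b : Ω) : α :=
  open Classical in if h : a ≤ b then φ ⟨(a, b), mem_orderEdges.2 h⟩ else d

theorem extendEdges_of_le {α : Type*} (d : α) (φ : orderEdges Ω → α) {a b : Ω} (h : a ≤ b) :
    extendEdges d φ a b = φ ⟨(a, b), mem_orderEdges.2 h⟩ := dif_pos h

theorem extendEdges_cases {α : Type*} {d : α} {φ : orderEdges Ω → α} {P : α → Prop} (hd : P d)
    (hφ : ∀ e, P (φ e)) (a b : Ω) : P (extendEdges d φ a b) := by
  unfold extendEdges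
  split_ifs with h
  exacts [hφ _, hd]

variable [TopologicalSpace Ω]

theorem isContractiveEvolution_extendEdges {φ : orderEdges Ω → (X →L[ℂ] X)}
    (hφ : IsDivisibleSystem φ) (hc : ∀ e, ‖φ e‖ ≤ 1) {ℓ : orderEdges Ω → ℝ≥0}
    (hℓ : IsSuperadditiveLength ℓ)
    (hg : ∀ e, ‖φ e - ContinuousLinearMap.id ℂ X‖ ≤ (ℓ e : ℝ)) :
    IsContractiveEvolution (extendEdges 1 φ) (fun a b => ((extendEdges 0 ℓ a b : ℝ≥0) : ℝ)) where
  self a := (extendEdges_of_le 1 φ (le_refl a)).trans (hφ.identity a _)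
  mul {a b c} hab hbc := by
    rw [extendEdges_of_le _ _ hab, extendEdges_of_le _ _ hbc, extendEdges_of_le _ _ (hab.trans hbc)]
    exact (hφ.divisible a b c hab hbc _).symm
  norm_le := extendEdges_cases (P := fun T : X →L[ℂ] X => ‖T‖ ≤ 1)
    ContinuousLinearMap.norm_id_le hc
  length_self a := by
    rw [extendEdges_of_le _ _ le_rfl, hℓ.loop, NNReal.coe_zero]
  nonneg _ _ := NNReal.coe_nonneg _
  superadd {a b c} hab hbc := by
    rw [extendEdges_of_le _ _ hab, extendEdges_of_le _ _ hbc, extendEdges_of_le _ _ (hab.trans hbc)]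
    exact_mod_cast hℓ.superadd a b c hab hbc _
  growth {a b} hab := by
    rw [extendEdges_of_le _ _ hab, extendEdges_of_le _ _ hab]
    exact hg _

theorem IsSuperadditiveLength.tendsto_zero [OrderClosedTopology Ω] {ℓ : orderEdges Ω → ℝ≥0}
    (hℓ : IsSuperadditiveLength ℓ) (a : Ω) :
    Tendsto (fun b => ((extendEdges 0 ℓ (min a b) (max a b) : ℝ≥0) : ℝ)) (𝓝 a) (𝓝 0) := by
  have hcont : Continuous fun b => (ℓ ⟨(min a b, max a b), mem_orderEdges.2 min_le_max⟩ : ℝ) :=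
    NNReal.continuous_coe.comp (hℓ.continuous.comp (Continuous.subtype_mk
      ((continuous_const.min continuous_id).prodMk (continuous_const.max continuous_id)) _))
  have := hcont.tendsto a
  simp only [min_self, max_self, hℓ.loop, NNReal.coe_zero] at this
  simpa only [extendEdges_of_le _ _ (min_le_max (a := a))] using this

end Extension

/-! ### Positivity and the C⋆-algebra of functions -/

section CStar

/-- Positivity expressed by the norm alone: this form passes between a C⋆-algebra of functions and
its values. -/
theorem nonneg_iff_norm_algebraMap_sub_le {A : Type*} [CStarAlgebra A] [PartialOrder A]
    [StarOrderedRing A] {a : A} {t : ℝ≥0} (ht : ‖a‖₊ ≤ t) :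
    0 ≤ a ↔ IsSelfAdjoint a ∧ ‖algebraMap ℝ A t - a‖ ≤ t := by
  rw [nonneg_iff_isSelfAdjoint_and_quasispectrumRestricts]
  refine and_congr_right fun ha => ?_
  rw [quasispectrumRestricts_iff_spectrumRestricts]
  exact SpectrumRestricts.nnreal_iff_nnnorm ha ht

variable {Ω : Type*} [LinearOrder Ω] [TopologicalSpace Ω] [TopologicalSpace (Finset Ω)]
  [DiscreteTopology (Finset Ω)] {A : Type*} [CStarAlgebra A]

variable (Ω A) in
/-- For a C⋆-algebra `A`, the space `continuousOrbits Ω A` as a C⋆-algebra of functions. -/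
noncomputable def continuousOrbitsStar : StarSubalgebra ℂ (Finset Ω →ᵇ A) where
  __ := continuousOrbits Ω A
  mul_mem' hf hg := Continuous.mul hf hg
  algebraMap_mem' c :=
    (continuous_const : Continuous fun _ : orderEdges Ω => algebraMap ℂ (Finset Ω →ᵇ A) c)
  star_mem' hf := Continuous.star hf

instance isClosed_continuousOrbitsStar :
    IsClosed (continuousOrbitsStar Ω A : Set (Finset Ω →ᵇ A)) :=
  isClosed_continuousOrbits

end CStar

/-! ### The dilations -/

theorem exists_isometric_dilation {Ω : Type u} [LinearOrder Ω] [TopologicalSpace Ω]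
    [OrderClosedTopology Ω] (X : Type v) [NormedAddCommGroup X] [NormedSpace ℂ X] [CompleteSpace X]
    (φ : orderEdges Ω → (X →L[ℂ] X)) (hφ : IsDivisibleSystem φ) (hc : ∀ e, ‖φ e‖ ≤ 1)
    (hg : HasGeometricGrowth φ) :
    ∃ (Y : Type (max u v)) (_ : NormedAddCommGroup Y) (_ : NormedSpace ℂ Y)
      (_ : CompleteSpace Y)
      (U : orderEdges Ω → (Y →L[ℂ] Y)) (j : Y →L[ℂ] X) (r : X →ₗᵢ[ℂ] Y),
      IsDivisibleSystem U ∧ StronglyContinuous U ∧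
      (∀ e, Isometry (U e) ∧ Function.Surjective (U e)) ∧
      ‖j‖ ≤ 1 ∧ Function.Surjective j ∧
      (∀ x, j (r x) = x) ∧
      (∀ e x, j (U e (r x)) = φ e x) := by
  obtain ⟨ℓ, hℓ, hgrow⟩ := hg
  have h := isContractiveEvolution_extendEdges hφ hc hℓ hgrow
  -- With the discrete topology, `Finset Ω →ᵇ _` consists of all bounded functions.
  let _ : TopologicalSpace (Finset Ω) := ⊥
  have _ : DiscreteTopology (Finset Ω) := ⟨rfl⟩
  let U (e : orderEdges Ω) : continuousOrbits Ω X →L[ℂ] continuousOrbits Ω X :=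
    ((edgeShift X e).comp (continuousOrbits Ω X).subtypeL).codRestrict _
      fun f => edgeShift_mem e f.2
  let r : X →ₗᵢ[ℂ] continuousOrbits Ω X :=
    { toLinearMap := h.lift.toLinearMap.codRestrict _ (h.lift_mem hℓ.tendsto_zero)
      norm_map' := h.lift.norm_map }
  let j : continuousOrbits Ω X →L[ℂ] X :=
    LinearMap.mkContinuous
      { toFun := fun f => f.1 ∅
        map_add' := fun _ _ => rfl
        map_smul' := fun _ _ => rfl } 1
      fun f => (f.1.norm_coe_le_norm ∅).trans_eq (one_mul _).symm
  have hjr (x : X) : j (r x) = x := h.lift_empty x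
  refine ⟨continuousOrbits Ω X, inferInstance, inferInstance,
    isClosed_continuousOrbits.completeSpace_coe, U, j, r, ⟨?_, ?_⟩, ?_, ?_, ?_, ?_, hjr, ?_⟩
  · exact fun a ha => ContinuousLinearMap.ext fun f => Subtype.ext (edgeShift_self a ha f.1)
  · exact fun a b c hab hbc hac =>
      ContinuousLinearMap.ext fun f => Subtype.ext (edgeShift_trans hab hbc hac f.1)
  · exact fun f => Continuous.subtype_mk f.2 _
  · exact fun e => ⟨AddMonoidHomClass.isometry_of_norm _ fun f => norm_edgeShift e f.1,
      fun f => ⟨U e f, Subtype.ext (edgeShift_edgeShift e f.1)⟩⟩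
  · exact LinearMap.mkContinuous_norm_le _ zero_le_one _
  · exact fun x => ⟨r x, hjr x⟩
  · exact fun e x => (h.edgeShift_lift_empty x e).trans (by rw [extendEdges_of_le _ _ e.2])

theorem exists_automorphic_dilation {Ω : Type u} [LinearOrder Ω] [TopologicalSpace Ω]
    [OrderClosedTopology Ω] (A : Type v) [CStarAlgebra A] [PartialOrder A] [StarOrderedRing A]
    (φ : orderEdges Ω → (A →L[ℂ] A)) (hφ : IsDivisibleSystem φ) (hc : ∀ e, ‖φ e‖ ≤ 1)
    (hg : HasGeometricGrowth φ) (hpos : ∀ e a, 0 ≤ a → 0 ≤ φ e a) (hone : ∀ e, φ e 1 = 1) :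
    ∃ (B : Type (max u v)) (_ : CStarAlgebra B) (_ : PartialOrder B) (_ : StarOrderedRing B)
      (U : orderEdges Ω → (B →L[ℂ] B)) (j : B →⋆ₐ[ℂ] A) (r : A →ₗᵢ[ℂ] B),
      ((∀ a b : A, a * b = b * a) → ∀ x y : B, x * y = y * x) ∧
      IsDivisibleSystem U ∧ StronglyContinuous U ∧
      (∀ e, ∃ α : B ≃⋆ₐ[ℂ] B, ∀ x, U e x = α x) ∧
      Function.Surjective j ∧
      (∀ a, 0 ≤ a → 0 ≤ r a) ∧ r 1 = 1 ∧
      (∀ a, j (r a) = a) ∧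
      (∀ e a, j (U e (r a)) = φ e a) := by
  obtain ⟨ℓ, hℓ, hgrow⟩ := hg
  have h := isContractiveEvolution_extendEdges hφ hc hℓ hgrow
  -- With the discrete topology, `Finset Ω →ᵇ _` consists of all bounded functions.
  let _ : TopologicalSpace (Finset Ω) := ⊥
  have _ : DiscreteTopology (Finset Ω) := ⟨rfl⟩
  -- The positive unital operators contain all factors, hence all the ordered products.
  let S : Submonoid (A →L[ℂ] A) :=
    { carrier := {T | (∀ a, 0 ≤ a → 0 ≤ T a) ∧ T 1 = 1}
      one_mem' := ⟨fun _ ha => ha, rfl⟩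
      mul_mem' := fun {T T'} hT hT' => ⟨fun a ha => hT.1 _ (hT'.1 a ha),
        (congrArg T hT'.2).trans hT.2⟩ }
  have hS (F : Finset Ω) : multisetProd (extendEdges 1 φ) F.val ∈ S :=
    multisetProd_mem _ S (extendEdges_cases (P := (· ∈ S)) S.one_mem
      fun e => ⟨hpos e, hone e⟩) _
  let B := continuousOrbitsStar Ω A
  let _ : PartialOrder B := CStarAlgebra.spectralOrder B
  have _ : StarOrderedRing B := CStarAlgebra.spectralOrderedRing B
  let U (e : orderEdges Ω) : B →L[ℂ] B :=
    { toFun := fun f => ⟨edgeShift A e f.1, edgeShift_mem e f.2⟩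
      map_add' := fun _ _ => rfl
      map_smul' := fun _ _ => rfl
      cont := ((edgeShift A e).continuous.comp continuous_subtype_val).subtype_mk _ }
  let j : B →⋆ₐ[ℂ] A :=
    { toFun := fun f => f.1 ∅
      map_one' := rfl
      map_mul' := fun _ _ => rfl
      map_zero' := rfl
      map_add' := fun _ _ => rfl
      commutes' := fun _ => rfl
      map_star' := fun _ => rfl }
  let r : A →ₗᵢ[ℂ] B :=
    { toFun := fun a => ⟨h.lift a, h.lift_mem hℓ.tendsto_zero a⟩
      map_add' := fun a b => Subtype.ext (map_add h.lift a b)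
      map_smul' := fun c a => Subtype.ext (map_smul h.lift c a)
      norm_map' := h.lift.norm_map }
  have hUU (e : orderEdges Ω) (f : B) : U e (U e f) = f := Subtype.ext (edgeShift_edgeShift e f.1)
  have hjr (a : A) : j (r a) = a := h.lift_empty a
  refine ⟨B, inferInstance, inferInstance, inferInstance, U, j, r, ?_, ⟨?_, ?_⟩, ?_, ?_, ?_, ?_, ?_,
    hjr, ?_⟩
  · exact fun hcomm f g => Subtype.ext (BoundedContinuousFunction.ext fun F => hcomm _ _)
  · exact fun a ha => ContinuousLinearMap.ext fun f => Subtype.ext (edgeShift_self a ha f.1)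
  · exact fun a b c hab hbc hac =>
      ContinuousLinearMap.ext fun f => Subtype.ext (edgeShift_trans hab hbc hac f.1)
  · exact fun f => Continuous.subtype_mk f.2 _
  · exact fun e => ⟨
      { toFun := U e
        invFun := U e
        left_inv := hUU e
        right_inv := hUU e
        map_mul' := fun _ _ => rfl
        map_add' := fun _ _ => rfl
        map_star' := fun _ => rfl
        map_smul' := fun _ _ => rfl }, fun _ => rfl⟩
  · exact fun a => ⟨r a, hjr a⟩
  · intro a ha
    have hF (F : Finset Ω) : 0 ≤ h.lift a F := (hS F).1 a ha
    rw [nonneg_iff_norm_algebraMap_sub_le (le_refl ‖r a‖₊)]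
    refine ⟨Subtype.ext (BoundedContinuousFunction.ext fun F => (hF F).isSelfAdjoint), ?_⟩
    refine (BoundedContinuousFunction.norm_le (NNReal.coe_nonneg _)).2 fun F => ?_
    exact ((nonneg_iff_norm_algebraMap_sub_le
      ((h.lift a).nnnorm_coe_le_nnnorm F)).1 (hF F)).2
  · exact Subtype.ext (BoundedContinuousFunction.ext fun F => (hS F).2)
  · exact fun e x => (h.edgeShift_lift_empty x e).trans (by rw [extendEdges_of_le _ _ e.2])

end GraphDilation

theorem theorem2 {Ω : Type u} [LinearOrder Ω] [TopologicalSpace Ω] [OrderTopology Ω] :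
    -- (a) Banach spaces
    (∀ (X : Type v) [NormedAddCommGroup X] [NormedSpace ℂ X] [CompleteSpace X]
        (φ : GraphDilation.orderEdges Ω → (X →L[ℂ] X)),
        GraphDilation.IsDivisibleSystem φ → (∀ e, ‖φ e‖ ≤ 1) →
        GraphDilation.HasGeometricGrowth φ →
        ∃ (Y : Type (max u v)) (_ : NormedAddCommGroup Y) (_ : NormedSpace ℂ Y)
          (_ : CompleteSpace Y)
          (U : GraphDilation.orderEdges Ω → (Y →L[ℂ] Y)) (j : Y →L[ℂ] X) (r : X →ₗᵢ[ℂ] Y),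
          GraphDilation.IsDivisibleSystem U ∧
          GraphDilation.StronglyContinuous U ∧
          (∀ e, Isometry (U e) ∧ Function.Surjective (U e)) ∧
          ‖j‖ ≤ 1 ∧ Function.Surjective j ∧
          (∀ x, j (r x) = x) ∧
          (∀ e x, j (U e (r x)) = φ e x)) ∧
    -- (b) unital (commutative) C*-algebras
    (∀ (A : Type v) [CStarAlgebra A] [PartialOrder A] [StarOrderedRing A]
        (φ : GraphDilation.orderEdges Ω → (A →L[ℂ] A)),
        GraphDilation.IsDivisibleSystem φ → (∀ e, ‖φ e‖ ≤ 1) →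
        GraphDilation.HasGeometricGrowth φ →
        (∀ e a, 0 ≤ a → 0 ≤ φ e a) → (∀ e, φ e 1 = 1) →
        ∃ (B : Type (max u v)) (_ : CStarAlgebra B) (_ : PartialOrder B) (_ : StarOrderedRing B)
          (U : GraphDilation.orderEdges Ω → (B →L[ℂ] B)) (j : B →⋆ₐ[ℂ] A) (r : A →ₗᵢ[ℂ] B),
          ((∀ a b : A, a * b = b * a) → ∀ x y : B, x * y = y * x) ∧
          GraphDilation.IsDivisibleSystem U ∧
          GraphDilation.StronglyContinuous U ∧
          (∀ e, ∃ α : B ≃⋆ₐ[ℂ] B, ∀ x, U e x = α x) ∧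
          Function.Surjective j ∧
          (∀ a, 0 ≤ a → 0 ≤ r a) ∧ r 1 = 1 ∧
          (∀ a, j (r a) = a) ∧
          (∀ e a, j (U e (r a)) = φ e a)) :=
  ⟨fun X _ _ _ => GraphDilation.exists_isometric_dilation X,
    fun A _ _ _ => GraphDilation.exists_automorphic_dilation A⟩
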